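/- Let $n\ge 1$ and write $B_\rho(y)$ for the open ball in $\mathbb R^n$. For a symmetric $n\times n$ matrix $H$ put $V(H)=\sqrt{\det(I+H^2)}$ and $a(H)=V(H)^{1/n}$, let $|H|=(\sum_{i,j}H_{ij}^2)^{1/2}$, and let $\|u\|_{C^{0,1}(B_1(0))}=\sup_{B_1(0)}|u|+\sup_{x\ne z\in B_1(0)}\frac{|u(x)-u(z)|}{|x-z|}$. For every $A\ge 0$ there is $R=R(n,A)\in(0,1/2]$ such that for every $0<r\le R$ the following holds. (1) There is a constant $C=C(r,n,A)$ such that for every constant $\Theta\in(-n\frac{\pi}{2},n\frac{\pi}{2})$, every smooth convex solution $u$ on $B_2(0)$ of the special Lagrangian equation $$\sum_{i=1}^n\arctan\lambda_i(D^2u)=\Theta$$ (where $\lambda_1,\dots,\lambda_n$ are the eigenvalues of $D^2u$) with $\|u\|_{C^{0,1}(B_1(0))}\le A$, and every $y\in B_{1/2}(0)$, $$\sup_{B_R(y)}a(D^2u)\le C\,\sup_{B_r(y)}a(D^2u).$$ (2) For every $M$ there is a constant $C'=C'(r,n,A,M)$ such that for all $\Theta$, $u$, $y$ as in (1) with $\sup_{B_r(y)}|D^2u|\le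 M$, $$\sup_{B_R(y)}|D^2u|\le C'.$$ The suprema over $B_R(y)$ are finite. -/

import Mathlib

open scoped NNReal ENNReal ContDiff

namespace SpecialLagrangian

/-- The Hessian matrix `D²u(x)`, with entries `u_ij = ∂²u / ∂xⁱ∂xʲ`. -/
noncomputable def hessian {n : ℕ} (u : EuclideanSpace ℝ (Fin n) → ℝ)
    (x : EuclideanSpace ℝ (Fin n)) : Matrix (Fin n) (Fin n) ℝ :=
  Matrix.of fun i j =>
    fderiv ℝ (fun z => fderiv ℝ u z (EuclideanSpace.single j 1)) x (EuclideanSpace.single i 1)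

/-- The Euclidean (Frobenius) size `|H| = (∑ H_ij²)^{1/2}` of a matrix. -/
noncomputable def matrixNorm {n : ℕ} (H : Matrix (Fin n) (Fin n) ℝ) : ℝ :=
  Real.sqrt (∑ i, ∑ j, H i j ^ 2)

/-- `u` solves `∑ arctan λ_i(D²u) = Θ` pointwise on `Ω`, where the `λ_i` are the eigenvalues,
with multiplicity, of the (symmetric) Hessian. -/
def SolvesSLag {n : ℕ} (Θ : ℝ) (Ω : Set (EuclideanSpace ℝ (Fin n)))
    (u : EuclideanSpace ℝ (Fin n) → ℝ) : Prop :=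
  ∀ x ∈ Ω, ∃ hH : (hessian u x).IsHermitian, ∑ i, Real.arctan (hH.eigenvalues i) = Θ

/-- The volume density `V = √det(I + H²)`. -/
noncomputable def volDensity {n : ℕ} (H : Matrix (Fin n) (Fin n) ℝ) : ℝ :=
  Real.sqrt (1 + H ^ 2).det

/-- `a = V^{1/n}`. -/
noncomputable def jacobiFun {n : ℕ} (H : Matrix (Fin n) (Fin n) ℝ) : ℝ :=
  volDensity H ^ (1 / (n : ℝ))

/-- The norm `‖u‖_{C^{0,1}(Ω)} = sup_Ω |u| + sup_{x ≠ y} |u(x) - u(y)| / |x - y|`,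
with values in `[0, ∞]`. -/
noncomputable def c01Norm {n : ℕ} (Ω : Set (EuclideanSpace ℝ (Fin n)))
    (u : EuclideanSpace ℝ (Fin n) → ℝ) : ℝ≥0∞ :=
  (⨆ x ∈ Ω, ‖u x‖ₑ) + ⨆ x ∈ Ω, ⨆ y ∈ Ω, ⨆ _ : x ≠ y, edist (u x) (u y) / edist x y

/-- `u` is a smooth convex solution, of phase `Θ ∈ (-nπ/2, nπ/2)`, of the special Lagrangian
equation on `B_2(0) ⊆ ℝⁿ`. -/
structure IsSmoothConvexSolution {n : ℕ} (Θ : ℝ) (u : EuclideanSpace ℝ (Fin n) → ℝ) : Prop where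
  phase : Θ ∈ Set.Ioo (-(n * (Real.pi / 2))) (n * (Real.pi / 2))
  smooth : ContDiffOn ℝ ∞ u (Metric.ball 0 2)
  convex : ConvexOn ℝ (Metric.ball 0 2) u
  solves : SolvesSLag Θ (Metric.ball 0 2) u

end SpecialLagrangian

/-! Write `g k = (1 + lam k ^ 2)⁻¹` in an eigenframe of `D²u` and `L = ∑ g k ∂_k²`. The proof is a
maximum principle for `L` on `B_{1/2}(y)`. On one side, `1/a = V^{-1/n}` is a supersolution. The
equation says that `exp(-iΘ) det(I + i D²u) = V`; the logarithmic derivatives of this identity have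
real part the derivatives of `log V` and imaginary part the differentiated equation. Together with
convexity they give `L log V ≥ (1/n) |∇ log V|_g²` (`jacobi_algebra`), that is, `L(1/a) ≤ 0`. On the
other side, `barrier` is `w = |x-y|²/2 + u(y) - u(x) + Du(x)(x-y)`. Convexity gives `w ≥ |x-y|²/2`.
The linearized equation kills the third derivatives of `u` in `L w`, leaving `L w = ∑ g k (1 + lam
k) ≤ 2n`, while `|∇w|_g² ≥ |x-y|²`. Hence `exp(-K w)` is a strict subsolution where `K |x-y|² > 2n`
(`not_isLocalMin_comparison`). With `K = (2n+1)/r²` and `S` a bound for `a` on `B_r(y)`, comparison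
gives `1/a ≥ S⁻¹ (exp(-K w) - exp(-K/8))` on `B_{1/2}(y)`. The Lipschitz bound makes `w < 1/8` on
`B_R(y)`, so the right side is at least a positive multiple of `S⁻¹` there (`jacobiFun_doubling`).
Part (2) follows from `|H| ≤ V = a^n` and `V ≤ (1 + |H|²)^{n/2}`. -/

namespace SpecialLagrangian

open Filter Topology

/-! ### Iterated directional derivatives and their symmetry. -/

section DirectionalDerivative

variable {E : Type*} [NormedAddCommGroup E] [NormedSpace ℝ E]

/-- The derivative of `f` in the direction `v`, as a function of the base point. -/
noncomputable def dirDeriv (v : E) (f : E → ℝ) (x : E) : ℝ := fderiv ℝ f x v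

theorem contDiffOn_dirDeriv {f : E → ℝ} {U : Set E} (hU : IsOpen U) (hf : ContDiffOn ℝ ∞ f U)
    (v : E) : ContDiffOn ℝ ∞ (dirDeriv v f) U :=
  (hf.fderiv_of_isOpen hU (by simp)).clm_apply contDiffOn_const

theorem differentiableAt_of_contDiffOn {f : E → ℝ} {U : Set E} (hU : IsOpen U)
    (hf : ContDiffOn ℝ ∞ f U) {x : E} (hx : x ∈ U) : DifferentiableAt ℝ f x :=
  (hf.differentiableOn (by simp)).differentiableAt (hU.mem_nhds hx)

theorem hasDerivAt_line {f : E → ℝ} {U : Set E} (hU : IsOpen U) (hf : ContDiffOn ℝ ∞ f U)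
    {x v : E} {t : ℝ} (ht : x + t • v ∈ U) :
    HasDerivAt (fun s : ℝ => f (x + s • v)) (dirDeriv v f (x + t • v)) t := by
  have h1 : HasDerivAt (fun s : ℝ => x + s • v) v t := by
    simpa using ((hasDerivAt_id t).smul_const v).const_add x
  exact (differentiableAt_of_contDiffOn hU hf ht).hasFDerivAt.comp_hasDerivAt t h1

theorem eventually_line_mem {U : Set E} (hU : IsOpen U) {x : E} (hx : x ∈ U) (v : E) :
    ∀ᶠ t : ℝ in 𝓝 0, x + t • v ∈ U := by
  have h : Continuous fun t : ℝ => x + t • v := by fun_prop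
  exact h.continuousAt.eventually_mem (hU.mem_nhds (by simpa using hx))

theorem dirDeriv_comm {f : E → ℝ} {U : Set E} (hU : IsOpen U) (hf : ContDiffOn ℝ ∞ f U)
    {x : E} (hx : x ∈ U) (v w : E) :
    dirDeriv v (dirDeriv w f) x = dirDeriv w (dirDeriv v f) x := by
  have hfx : ContDiffAt ℝ ∞ f x := hf.contDiffAt (hU.mem_nhds hx)
  have hd : DifferentiableAt ℝ (fderiv ℝ f) x :=
    ((hf.fderiv_of_isOpen (m := ∞) hU (by simp)).differentiableOn (by simp)).differentiableAt
      (hU.mem_nhds hx)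
  have key : ∀ a b : E, dirDeriv a (dirDeriv b f) x = fderiv ℝ (fderiv ℝ f) x a b := by
    intro a b
    have := fderiv_clm_apply hd (differentiableAt_const b)
    change fderiv ℝ (fun z => fderiv ℝ f z b) x a = _
    rw [this]; simp
  rw [key, key]
  exact (hfx.isSymmSndFDerivAt (by simpa using WithTop.coe_le_coe.2 (le_top : (2 : ℕ∞) ≤ ⊤))) v w

theorem dirDeriv_congr {f g : E → ℝ} {U : Set E} (hU : IsOpen U) (h : Set.EqOn f g U)
    {x : E} (hx : x ∈ U) (v : E) : dirDeriv v f x = dirDeriv v g x := by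
  unfold dirDeriv
  rw [(h.eventuallyEq_of_mem (hU.mem_nhds hx)).fderiv_eq]

theorem dirDeriv_sum {ι : Type*} (s : Finset ι) (c : ι → ℝ) (v : ι → E) (f : E → ℝ) (x : E) :
    dirDeriv (∑ i ∈ s, c i • v i) f x = ∑ i ∈ s, c i * dirDeriv (v i) f x := by
  simp [dirDeriv, map_sum]

/-- Linearity is immediate only in the outer direction; commuting the two derivatives brings the
inner one outside. -/
theorem dirDeriv_dirDeriv_sum {ι κ : Type*} {f : E → ℝ} {U : Set E} (hU : IsOpen U)
    (hf : ContDiffOn ℝ ∞ f U) {x : E} (hx : x ∈ U) (s : Finset ι) (c : ι → ℝ) (v : ι → E)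
    (s' : Finset κ) (c' : κ → ℝ) (v' : κ → E) :
    dirDeriv (∑ i ∈ s, c i • v i) (dirDeriv (∑ j ∈ s', c' j • v' j) f) x =
      ∑ i ∈ s, ∑ j ∈ s', c i * c' j * dirDeriv (v i) (dirDeriv (v' j) f) x := by
  rw [dirDeriv_sum]
  refine Finset.sum_congr rfl fun i _ => ?_
  rw [dirDeriv_comm hU hf hx, dirDeriv_sum, Finset.mul_sum]
  refine Finset.sum_congr rfl fun j _ => ?_
  rw [dirDeriv_comm hU hf hx, mul_assoc]

end DirectionalDerivative

/-! ### One-variable calculus and tangent planes of convex functions. -/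

/-- The second derivative of a real function is nonnegative at a local minimum. -/
theorem second_deriv_nonneg_of_isLocalMin {f f' : ℝ → ℝ} {f'' a : ℝ}
    (hf : ∀ᶠ t in 𝓝 a, HasDerivAt f (f' t) t) (hf' : HasDerivAt f' f'' a)
    (hmin : IsLocalMin f a) : 0 ≤ f'' := by
  by_contra! hneg
  have hd : deriv f =ᶠ[𝓝 a] f' := hf.mono fun t ht => ht.deriv
  have h2 : deriv (deriv f) a = f'' := by rw [hd.deriv_eq]; exact hf'.deriv
  have hmax : IsLocalMax f a := isLocalMax_of_deriv_deriv_neg (by rw [h2]; exact hneg)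
    hmin.deriv_eq_zero hf.self_of_nhds.continuousAt
  -- A point that is both a local minimum and a local maximum makes `f` locally constant, so `f'' =
  -- 0`.
  have hconst : f =ᶠ[𝓝 a] fun _ => f a := by
    filter_upwards [hmin, hmax] with t h1 h2 using le_antisymm h2 h1
  have h3 : deriv f =ᶠ[𝓝 a] fun _ => 0 := by
    have := hconst.deriv
    simpa using this
  rw [h3.deriv_eq] at h2
  simp at h2
  exact hneg.ne h2.symm

/-- First and second derivatives of `exp ∘ h`. -/
theorem hasDerivAt_exp_comp_second {h h' : ℝ → ℝ} {h'' a : ℝ}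
    (hh : HasDerivAt h (h' a) a) (hh' : HasDerivAt h' h'' a) :
    HasDerivAt (fun t => Real.exp (h t) * h' t) (Real.exp (h a) * (h'' + h' a ^ 2)) a := by
  exact (hh.exp.mul hh').congr_deriv (by ring)

/-- A convex function lies above its tangent hyperplanes. -/
theorem convexOn_tangent_le {E : Type*} [NormedAddCommGroup E] [NormedSpace ℝ E] {f : E → ℝ}
    {U : Set E} (hf : ConvexOn ℝ U f) {x y : E} (hx : x ∈ U) (hy : y ∈ U)
    (hd : DifferentiableAt ℝ f x) : f x + fderiv ℝ f x (y - x) ≤ f y := by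
  have h1 : HasDerivAt (fun s : ℝ => f (x + s • (y - x))) (fderiv ℝ f x (y - x)) 0 := by
    have h1 : HasDerivAt (fun s : ℝ => x + s • (y - x)) (y - x) 0 := by
      simpa using ((hasDerivAt_id (0 : ℝ)).smul_const (y - x)).const_add x
    have h2 : HasFDerivAt f (fderiv ℝ f x) (x + (0 : ℝ) • (y - x)) := by
      simpa using hd.hasFDerivAt
    exact h2.comp_hasDerivAt 0 h1
  have h2 : Tendsto (slope (fun s : ℝ => f (x + s • (y - x))) 0) (𝓝[>] 0)
      (𝓝 (fderiv ℝ f x (y - x))) :=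
    (hasDerivAt_iff_tendsto_slope.1 h1).mono_left (nhdsWithin_mono _ fun t ht => ne_of_gt ht)
  have h3 : fderiv ℝ f x (y - x) ≤ f y - f x := by
    refine le_of_tendsto h2 ?_
    filter_upwards [Ioo_mem_nhdsGT (show (0 : ℝ) < 1 by norm_num)] with t ht
    have hc := hf.2 hx hy (sub_nonneg.2 ht.2.le) ht.1.le (by ring)
    have he : (1 - t) • x + t • y = x + t • (y - x) := by module
    rw [he] at hc
    simp only [smul_eq_mul] at hc
    rw [slope_def_field, div_le_iff₀ (by simpa using ht.1)]
    simp
    nlinarith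
  linarith

/-! ### Differentiation of determinants and inverses along curves of matrices. -/

section MatrixCurves

open scoped Matrix.Norms.Operator
open Matrix

variable {ι : Type*} [Fintype ι] [DecidableEq ι]

theorem hasDerivAt_matrix {M : ℝ → Matrix ι ι ℂ} {M' : Matrix ι ι ℂ} {t : ℝ}
    (h : ∀ i j, HasDerivAt (fun s => M s i j) (M' i j) t) : HasDerivAt M M' t := by
  have h1 : HasDerivAt (fun s => ∑ i, ∑ j, M s i j • Matrix.single i j (1 : ℂ))
      (∑ i, ∑ j, M' i j • Matrix.single i j (1 : ℂ)) t :=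
    HasDerivAt.fun_sum fun i _ => HasDerivAt.fun_sum fun j _ => (h i j).smul_const _
  have h2 : ∀ N : Matrix ι ι ℂ, ∑ i, ∑ j, N i j • Matrix.single i j (1 : ℂ) = N := by
    intro N
    conv_rhs => rw [matrix_eq_sum_single N]
    simp [Matrix.smul_single]
  simpa only [h2] using h1

theorem hasDerivAt_trace {κ : Type*} [Fintype κ] {M : ℝ → Matrix κ κ ℂ}
    {M' : Matrix κ κ ℂ} {t : ℝ}
    (h : HasDerivAt M M' t) : HasDerivAt (fun s => (M s).trace) M'.trace t :=
  ((Matrix.traceLinearMap κ ℝ ℂ).toContinuousLinearMap.hasFDerivAt).comp_hasDerivAt t h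

theorem hasDerivAt_inv {M : ℝ → Matrix ι ι ℂ} {M' : Matrix ι ι ℂ} {t : ℝ}
    (h : HasDerivAt M M' t) (hdet : (M t).det ≠ 0) :
    HasDerivAt (fun s => (M s)⁻¹) (-((M t)⁻¹ * M' * (M t)⁻¹)) t := by
  have hu : IsUnit (M t) := (Matrix.isUnit_iff_isUnit_det _).2 hdet.isUnit
  obtain ⟨u, hu⟩ := hu
  have h1 := hasFDerivAt_ringInverse (𝕜 := ℝ) u
  rw [hu] at h1
  have h2 := h1.comp_hasDerivAt t h
  have h3 : ((u⁻¹ : (Matrix ι ι ℂ)ˣ) : Matrix ι ι ℂ) = (M t)⁻¹ := by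
    rw [← hu, Matrix.coe_units_inv]
  simp only [h3] at h2
  refine HasDerivAt.congr_of_eventuallyEq (f := Ring.inverse ∘ M) ?_ ?_
  · simpa using h2
  · exact Eventually.of_forall fun s => by simp [Matrix.nonsing_inv_eq_ringInverse]

/-- Jacobi's formula. -/
theorem hasDerivAt_det {M : ℝ → Matrix ι ι ℂ} {M' : Matrix ι ι ℂ} {t : ℝ}
    (h : ∀ i j, HasDerivAt (fun s => M s i j) (M' i j) t) :
    HasDerivAt (fun s => (M s).det) ((M t).adjugate * M').trace t := by
  have h1 : HasDerivAt (fun s => (M s).det)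
      (∑ σ : Equiv.Perm ι, ((Equiv.Perm.sign σ : ℤ) : ℂ) *
        ∑ i, (∏ j ∈ Finset.univ.erase i, M t (σ j) j) • M' (σ i) i) t := by
    simp only [Matrix.det_apply']
    exact HasDerivAt.fun_sum fun σ _ =>
      (HasDerivAt.fun_finsetProd fun i _ => h (σ i) i).const_mul _
  -- By Cramer's rule the trace is the sum over `i` of the determinants with column `i` replaced by
  -- that of `M'`, as in the product rule.
  refine h1.congr_deriv ?_
  have h2 : ((M t).adjugate * M').trace = ∑ i, ((M t).updateCol i (fun k => M' k i)).det := by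
    refine Finset.sum_congr rfl fun i _ => ?_
    rw [← Matrix.cramer_apply, Matrix.cramer_eq_adjugate_mulVec]
    rfl
  rw [h2]
  simp only [Matrix.det_apply', Finset.mul_sum]
  rw [Finset.sum_comm]
  refine Finset.sum_congr rfl fun i _ => Finset.sum_congr rfl fun σ _ => ?_
  congr 1
  rw [← Finset.mul_prod_erase Finset.univ _ (Finset.mem_univ i), mul_comm, smul_eq_mul, mul_comm,
    mul_comm _ (∏ _ ∈ _, _)]
  congr 1
  · exact Finset.prod_congr rfl fun j hj => by
      rw [Matrix.updateCol_ne (Finset.ne_of_mem_erase hj)]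
  · simp

/-- First and second derivatives of the logarithm of a determinant along a curve of matrices. -/
theorem log_det_derivatives {M M₁ : ℝ → Matrix ι ι ℂ} {M₂ : Matrix ι ι ℂ} {l l₁ : ℝ → ℝ} {l₂ : ℝ}
    (c : ℂ) (hM : ∀ᶠ t in 𝓝 (0 : ℝ), ∀ i j, HasDerivAt (fun s => M s i j) (M₁ t i j) t)
    (hM₁ : ∀ i j, HasDerivAt (fun s => M₁ s i j) (M₂ i j) 0)
    (hl : ∀ᶠ t in 𝓝 (0 : ℝ), HasDerivAt l (l₁ t) t) (hl₁ : HasDerivAt l₁ l₂ 0)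
    (hdet : ∀ᶠ t in 𝓝 (0 : ℝ), c * (M t).det = Real.exp (l t)) :
    (l₁ 0 : ℂ) = ((M 0)⁻¹ * M₁ 0).trace ∧
      (l₂ : ℂ) = ((M 0)⁻¹ * M₂).trace - ((M 0)⁻¹ * M₁ 0 * ((M 0)⁻¹ * M₁ 0)).trace := by
  have hne : ∀ᶠ t in 𝓝 (0 : ℝ), (M t).det ≠ 0 := by
    filter_upwards [hdet] with t ht h0
    rw [h0, mul_zero] at ht
    exact (Real.exp_pos (l t)).ne' (by exact_mod_cast ht.symm)
  -- The first-order identity is proved on a neighbourhood so that it can be differentiated again;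
  -- the constant `c` cancels.
  have key : ∀ᶠ t in 𝓝 (0 : ℝ), (l₁ t : ℂ) = ((M t)⁻¹ * M₁ t).trace := by
    filter_upwards [hM, hl, hdet.eventually_nhds, hne] with t h1 h2 h3 h4
    have h5 := (hasDerivAt_det h1).const_mul c
    have h6 : HasDerivAt (fun s => ((Real.exp (l s) : ℝ) : ℂ))
        ((Real.exp (l t) * l₁ t : ℝ) : ℂ) t := h2.exp.ofReal_comp
    have h7 := (h6.congr_of_eventuallyEq h3).unique h5
    rw [Complex.ofReal_mul, ← h3.self_of_nhds] at h7
    have h8 : ((M t)⁻¹ * M₁ t).trace = (M t).det⁻¹ * ((M t).adjugate * M₁ t).trace := by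
      rw [Matrix.inv_def, Ring.inverse_eq_inv', Matrix.smul_mul, Matrix.trace_smul, smul_eq_mul]
    have hc : c ≠ 0 := by
      rintro rfl
      have := h3.self_of_nhds
      rw [zero_mul] at this
      exact (Real.exp_pos (l t)).ne' (by exact_mod_cast this.symm)
    rw [h8]
    field_simp
    have h9 : c * ((M t).det * (l₁ t : ℂ)) = c * ((M t).adjugate * M₁ t).trace := by
      rw [← mul_assoc]; exact h7
    have := mul_left_cancel₀ hc h9
    linear_combination this
  refine ⟨key.self_of_nhds, ?_⟩
  have h1 : HasDerivAt (fun t => (l₁ t : ℂ)) (l₂ : ℂ) 0 := hl₁.ofReal_comp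
  have h2 := hasDerivAt_trace ((hasDerivAt_inv (hasDerivAt_matrix hM.self_of_nhds)
    hne.self_of_nhds).mul (hasDerivAt_matrix hM₁))
  have h3 := (h1.congr_of_eventuallyEq (key.mono fun t ht => ht.symm)).unique h2
  rw [h3, Matrix.trace_add, Matrix.neg_mul, Matrix.trace_neg]
  simp only [Matrix.mul_assoc]
  ring

end MatrixCurves

/-! ### Spectral formulas for the volume density and the phase. -/

section Spectral

variable {n : ℕ} {H : Matrix (Fin n) (Fin n) ℝ}

theorem exists_diagonalization (hH : H.IsHermitian) :
    ∃ P Q : Matrix (Fin n) (Fin n) ℝ, P * Q = 1 ∧ Q * P = 1 ∧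
      H = P * Matrix.diagonal hH.eigenvalues * Q := by
  refine ⟨hH.eigenvectorUnitary, star (hH.eigenvectorUnitary : Matrix (Fin n) (Fin n) ℝ),
    ?_, ?_, ?_⟩
  · simp
  · simp
  · have := hH.spectral_theorem
    rwa [Unitary.conjStarAlgAut_apply] at this

theorem det_one_add_smul_eq_prod (hH : H.IsHermitian) (z : ℂ) :
    (1 + z • H.map Complex.ofReal).det = ∏ i, (1 + z * (hH.eigenvalues i : ℂ)) := by
  obtain ⟨P, Q, h1, h2, h3⟩ := exists_diagonalization hH
  set D := hH.eigenvalues with hD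
  have hmap : ∀ A B : Matrix (Fin n) (Fin n) ℝ,
      (A * B).map Complex.ofReal = A.map Complex.ofReal * B.map Complex.ofReal :=
    fun A B => Matrix.map_mul (f := Complex.ofRealHom)
  have hone : (1 : Matrix (Fin n) (Fin n) ℝ).map Complex.ofReal = 1 :=
    Matrix.map_one _ Complex.ofReal_zero Complex.ofReal_one
  have hPQ : P.map Complex.ofReal * Q.map Complex.ofReal = 1 := by rw [← hmap, h1, hone]
  have hdiag : (Matrix.diagonal D).map Complex.ofReal =
      Matrix.diagonal fun i => (D i : ℂ) := by
    rw [Matrix.diagonal_map Complex.ofReal_zero]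
  have h4 : 1 + z • H.map Complex.ofReal =
      P.map Complex.ofReal * (Matrix.diagonal fun i => 1 + z * (D i : ℂ)) * Q.map Complex.ofReal := by
    have : (Matrix.diagonal fun i => 1 + z * (D i : ℂ)) =
        1 + z • Matrix.diagonal fun i => (D i : ℂ) := by
      rw [← Matrix.diagonal_one, ← Matrix.diagonal_smul, Matrix.diagonal_add]
      rfl
    rw [this, Matrix.mul_add, Matrix.add_mul, mul_one, hPQ, h3, hmap, hmap, hdiag]
    simp
  rw [h4, Matrix.det_mul, Matrix.det_mul, Matrix.det_diagonal, mul_right_comm, ← Matrix.det_mul,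
    hPQ, Matrix.det_one, one_mul]

theorem det_one_add_sq_eq_prod (hH : H.IsHermitian) :
    (1 + H ^ 2).det = ∏ i, (1 + hH.eigenvalues i ^ 2) := by
  obtain ⟨P, Q, h1, h2, h3⟩ := exists_diagonalization hH
  set D := hH.eigenvalues with hD
  have h4 : 1 + H ^ 2 = P * (Matrix.diagonal fun i => 1 + D i ^ 2) * Q := by
    have : (Matrix.diagonal fun i => 1 + D i ^ 2) =
        1 + Matrix.diagonal D * Matrix.diagonal D := by
      rw [← Matrix.diagonal_one, Matrix.diagonal_mul_diagonal, Matrix.diagonal_add]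
      simp [sq]
    rw [this, Matrix.mul_add, Matrix.add_mul, mul_one, h1, h3, sq]
    congr 1
    calc P * Matrix.diagonal D * Q * (P * Matrix.diagonal D * Q)
        = P * Matrix.diagonal D * (Q * P) * Matrix.diagonal D * Q := by
          simp only [Matrix.mul_assoc]
      _ = _ := by rw [h2]; simp [Matrix.mul_assoc]
  rw [h4, Matrix.det_mul, Matrix.det_mul, Matrix.det_diagonal, mul_right_comm, ← Matrix.det_mul,
    h1, Matrix.det_one, one_mul]

theorem sum_sq_eq_sum_eigenvalues_sq (hH : H.IsHermitian) :
    ∑ i, ∑ j, H i j ^ 2 = ∑ i, hH.eigenvalues i ^ 2 := by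
  obtain ⟨P, Q, h1, h2, h3⟩ := exists_diagonalization hH
  set D := hH.eigenvalues with hD
  have h4 : ∑ i, ∑ j, H i j ^ 2 = (H * H).trace := by
    simp only [Matrix.trace, Matrix.diag, Matrix.mul_apply]
    refine Finset.sum_congr rfl fun i _ => Finset.sum_congr rfl fun j _ => ?_
    have : H j i = H i j := by simpa using hH.apply i j
    rw [this, sq]
  have h5 : H * H = P * (Matrix.diagonal D * Matrix.diagonal D * Q) := by
    conv_lhs => rw [h3]
    calc P * Matrix.diagonal D * Q * (P * Matrix.diagonal D * Q)
        = P * Matrix.diagonal D * (Q * P) * Matrix.diagonal D * Q := by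
          simp only [Matrix.mul_assoc]
      _ = _ := by rw [h2]; simp [Matrix.mul_assoc]
  rw [h4, h5, Matrix.trace_mul_comm, Matrix.mul_assoc, h2, mul_one, Matrix.diagonal_mul_diagonal,
    Matrix.trace_diagonal]
  simp [sq]

theorem volDensity_eq_prod (hH : H.IsHermitian) :
    volDensity H = ∏ i, Real.sqrt (1 + hH.eigenvalues i ^ 2) := by
  rw [volDensity, det_one_add_sq_eq_prod hH, Real.sqrt_prod _ fun i _ => by positivity]

theorem one_le_volDensity (hH : H.IsHermitian) : 1 ≤ volDensity H := by
  rw [volDensity_eq_prod hH]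
  refine Finset.prod_induction _ (fun x : ℝ => 1 ≤ x)
    (fun _ _ => one_le_mul_of_one_le_of_one_le) le_rfl fun i _ => ?_
  rw [Real.one_le_sqrt]
  nlinarith [sq_nonneg (hH.eigenvalues i)]

theorem one_add_mul_I_eq (x : ℝ) :
    1 + Complex.I * (x : ℂ) =
      (Real.sqrt (1 + x ^ 2) : ℂ) * Complex.exp (Real.arctan x * Complex.I) := by
  have h : Real.sqrt (1 + x ^ 2) ≠ 0 := (Real.sqrt_pos.2 (by positivity)).ne'
  rw [Complex.exp_mul_I, ← Complex.ofReal_cos, ← Complex.ofReal_sin, Real.cos_arctan,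
    Real.sin_arctan]
  have h' : (Real.sqrt (1 + x ^ 2) : ℂ) ≠ 0 := by exact_mod_cast h
  push_cast
  field_simp

/-- Each factor `1 + i lam` has modulus `√(1 + lam²)` and argument `arctan lam`, so the determinant
has argument `Θ`. This turns the equation into an identity polynomial in the Hessian on one side. -/
theorem exp_neg_mul_det_eq_volDensity (hH : H.IsHermitian) {Θ : ℝ}
    (h : ∑ i, Real.arctan (hH.eigenvalues i) = Θ) :
    Complex.exp (-(Θ * Complex.I)) * (1 + Complex.I • H.map Complex.ofReal).det =
      (volDensity H : ℂ) := by
  rw [det_one_add_smul_eq_prod hH, volDensity_eq_prod hH]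
  simp only [one_add_mul_I_eq, Finset.prod_mul_distrib]
  rw [← Complex.exp_sum, ← Finset.sum_mul, ← Complex.ofReal_sum, h, mul_comm, mul_assoc,
    ← Complex.exp_add]
  simp

theorem matrixNorm_le_volDensity (hH : H.IsHermitian) : matrixNorm H ≤ volDensity H := by
  unfold matrixNorm volDensity
  refine Real.sqrt_le_sqrt ?_
  rw [sum_sq_eq_sum_eigenvalues_sq hH, det_one_add_sq_eq_prod hH]
  -- The product of the `1 + lam²` contains `1` and every `lam²` among its nonnegative terms.
  have : ∀ s : Finset (Fin n), 1 + ∑ i ∈ s, hH.eigenvalues i ^ 2 ≤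
      ∏ i ∈ s, (1 + hH.eigenvalues i ^ 2) := by
    intro s
    induction s using Finset.induction_on with
    | empty => simp
    | insert a s ha ih =>
      rw [Finset.sum_insert ha, Finset.prod_insert ha]
      have h0 : 0 ≤ ∑ i ∈ s, hH.eigenvalues i ^ 2 := Finset.sum_nonneg fun i _ => sq_nonneg _
      have h1 := sq_nonneg (hH.eigenvalues a)
      nlinarith [mul_le_mul_of_nonneg_left ih h1, mul_nonneg h0 h1]
  linarith [this Finset.univ]

theorem volDensity_le (hH : H.IsHermitian) {M : ℝ} (hM : matrixNorm H ≤ M) :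
    volDensity H ≤ Real.sqrt ((1 + M ^ 2) ^ n) := by
  have h1 : ∑ i, hH.eigenvalues i ^ 2 ≤ M ^ 2 := by
    rw [← sum_sq_eq_sum_eigenvalues_sq hH]
    exact (Real.sqrt_le_left (le_trans (Real.sqrt_nonneg _) hM)).1 hM
  unfold volDensity
  refine Real.sqrt_le_sqrt ?_
  rw [det_one_add_sq_eq_prod hH]
  calc ∏ i, (1 + hH.eigenvalues i ^ 2) ≤ ∏ _i : Fin n, (1 + M ^ 2) := by
        refine Finset.prod_le_prod (fun i _ => by positivity) fun i _ => ?_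
        have := Finset.single_le_sum (f := fun i => hH.eigenvalues i ^ 2)
          (fun i _ => sq_nonneg _) (Finset.mem_univ i)
        linarith
    _ = (1 + M ^ 2) ^ n := by simp

end Spectral

/-! ### The Jacobi inequality as algebra. -/

/-- The pointwise algebra behind the Jacobi inequality for `log V`: `T` stands for the third
derivatives of a convex solution in an eigenframe, `F` for the fourth ones, and `l₁`, `l₂` for the
first and second derivatives of `log V`. -/
theorem jacobi_algebra {n : ℕ} (hn : 1 ≤ n) {lam l₁ l₂ : Fin n → ℝ}
    {T : Fin n → Fin n → Fin n → ℝ} {F : Fin n → Fin n → ℝ} (hlam : ∀ i, 0 ≤ lam i)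
    (hT₁ : ∀ a b c, T a b c = T b a c) (hT₂ : ∀ a b c, T a b c = T c b a)
    (hF : ∀ a b, F a b = F b a)
    (h₁ : ∀ k, (l₁ k : ℂ) = ∑ a, (1 + Complex.I * lam a)⁻¹ * (Complex.I * T a a k))
    (h₂ : ∀ k, (l₂ k : ℂ) = ∑ a, (1 + Complex.I * lam a)⁻¹ * (Complex.I * F a k) -
      ∑ a, ∑ b, (1 + Complex.I * lam a)⁻¹ * (Complex.I * T a b k) *
        ((1 + Complex.I * lam b)⁻¹ * (Complex.I * T b a k))) :
    (∀ k, ∑ a, (1 + lam a ^ 2)⁻¹ * T a a k = 0) ∧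
      1 / n * ∑ k, (1 + lam k ^ 2)⁻¹ * l₁ k ^ 2 ≤ ∑ k, (1 + lam k ^ 2)⁻¹ * l₂ k := by
  set g : Fin n → ℝ := fun a => (1 + lam a ^ 2)⁻¹ with hg
  have hgpos : ∀ a, 0 < g a := fun a => by simp only [hg]; positivity
  have hz : ∀ a, (1 + Complex.I * (lam a : ℂ))⁻¹ * Complex.I =
      ((lam a * g a : ℝ) : ℂ) + ((g a : ℝ) : ℂ) * Complex.I := by
    intro a
    have h1 : (1 + Complex.I * (lam a : ℂ)) ≠ 0 := by
      intro h
      have := congrArg Complex.re h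
      simp at this
    have h2 : ((1 + lam a ^ 2 : ℝ) : ℂ) ≠ 0 := by
      exact_mod_cast (by positivity : (1 + lam a ^ 2) ≠ 0)
    simp only [hg]
    push_cast at h2 ⊢
    rw [inv_mul_eq_div, div_eq_iff h1]
    field_simp
    linear_combination (-(lam a : ℂ)) * Complex.I_sq
  have hz1 : ∀ a (x : ℝ), (1 + Complex.I * (lam a : ℂ))⁻¹ * (Complex.I * (x : ℂ)) =
      ((lam a * g a * x : ℝ) : ℂ) + ((g a * x : ℝ) : ℂ) * Complex.I := by
    intro a x
    rw [← mul_assoc, hz]; push_cast; ring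
  have hz2 : ∀ a b (x y : ℝ), (1 + Complex.I * (lam a : ℂ))⁻¹ * (Complex.I * (x : ℂ)) *
      ((1 + Complex.I * (lam b : ℂ))⁻¹ * (Complex.I * (y : ℂ))) =
      (((lam a * lam b - 1) * (g a * g b) * (x * y) : ℝ) : ℂ) +
        (((lam a + lam b) * (g a * g b) * (x * y) : ℝ) : ℂ) * Complex.I := by
    intro a b x y
    rw [hz1, hz1]; push_cast
    linear_combination ((g a : ℂ) * x * g b * y) * Complex.I_sq
  have re1 : ∀ k, l₁ k = ∑ a, lam a * g a * T a a k := by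
    intro k
    have := congrArg Complex.re (h₁ k)
    simpa [hz1, -Complex.ofReal_mul] using this
  have im1 : ∀ k, ∑ a, g a * T a a k = 0 := by
    intro k
    have := congrArg Complex.im (h₁ k)
    simpa [hz1, -Complex.ofReal_mul, eq_comm] using this
  have re2 : ∀ k, l₂ k = ∑ a, lam a * g a * F a k -
      ∑ a, ∑ b, (lam a * lam b - 1) * (g a * g b) * (T a b k * T b a k) := by
    intro k
    have := congrArg Complex.re (h₂ k)
    simp only [hz2] at this
    simp only [hz1] at this
    simpa [-Complex.ofReal_mul] using this
  have im2 : ∀ k, ∑ a, g a * F a k =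
      ∑ a, ∑ b, (lam a + lam b) * (g a * g b) * (T a b k * T b a k) := by
    intro k
    have := congrArg Complex.im (h₂ k)
    simp only [hz2] at this
    simp only [hz1] at this
    simp [-Complex.ofReal_mul] at this
    linarith
  refine ⟨im1, ?_⟩
  -- `P` is symmetric in all three indices, so indices can be permuted in every sum below.
  let P : Fin n → Fin n → Fin n → ℝ := fun a b c => g a * g b * g c * T a b c ^ 2
  have hPnn : ∀ a b c, 0 ≤ P a b c := fun a b c => by
    have := hgpos a; have := hgpos b; have := hgpos c
    positivity
  have hP₁ : ∀ a b c, P a b c = P b a c := fun a b c => by simp only [P, hT₁ a b c]; ring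
  have hP₂ : ∀ a b c, P a b c = P c b a := fun a b c => by simp only [P, hT₂ a b c]; ring
  -- Symmetry of `F` exchanges the two derivative pairs; the imaginary part `im2` then trades fourth
  -- derivatives for squares of third ones.
  have e1 : ∑ k, g k * ∑ a, lam a * g a * F a k =
      ∑ c, ∑ a, ∑ b, (lam c * lam a + lam c * lam b) * P a b c := by
    calc ∑ k, g k * ∑ a, lam a * g a * F a k
        = ∑ a, lam a * g a * ∑ k, g k * F k a := by
          simp only [Finset.mul_sum]
          rw [Finset.sum_comm]
          refine Finset.sum_congr rfl fun a _ => Finset.sum_congr rfl fun k _ => ?_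
          rw [hF a k]; ring
      _ = _ := by
          refine Finset.sum_congr rfl fun c _ => ?_
          rw [im2 c]
          simp only [Finset.mul_sum]
          refine Finset.sum_congr rfl fun a _ => Finset.sum_congr rfl fun b _ => ?_
          simp only [P, hT₁ b a c]; ring
  have e2 : ∑ k, g k * ∑ a, ∑ b, (lam a * lam b - 1) * (g a * g b) * (T a b k * T b a k) =
      ∑ c, ∑ a, ∑ b, (lam a * lam b - 1) * P a b c := by
    simp only [Finset.mul_sum]
    refine Finset.sum_congr rfl fun c _ => Finset.sum_congr rfl fun a _ =>
      Finset.sum_congr rfl fun b _ => ?_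
    simp only [P, hT₁ b a c]; ring
  have e3 : ∑ c, ∑ a, ∑ b, lam c * lam a * P a b c = ∑ c, ∑ a, ∑ b, lam a * lam b * P a b c := by
    calc ∑ c, ∑ a, ∑ b, lam c * lam a * P a b c
        = ∑ b, ∑ a, ∑ c, lam c * lam a * P a b c := by
          exact (Finset.sum_congr rfl fun c _ => Finset.sum_comm).trans
            (Finset.sum_comm.trans (Finset.sum_congr rfl fun b _ => Finset.sum_comm))
      _ = _ := by
          refine Finset.sum_congr rfl fun c _ => Finset.sum_congr rfl fun a _ =>
            Finset.sum_congr rfl fun b _ => ?_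
          rw [hP₁ a c b, hP₂ c a b, hP₁ b a c]; ring
  have e4 : ∑ c, ∑ a, ∑ b, lam c * lam b * P a b c = ∑ c, ∑ a, ∑ b, lam c * lam a * P a b c := by
    refine Finset.sum_congr rfl fun c _ => ?_
    rw [Finset.sum_comm]
    exact Finset.sum_congr rfl fun a _ => Finset.sum_congr rfl fun b _ => by rw [hP₁]
  -- The coefficient is `lam c lam a + lam c lam b - lam a lam b + 1`; after symmetrization one
  -- product cancels.
  have e5 : ∑ k, g k * l₂ k = ∑ c, ∑ a, ∑ b, (1 + lam a * lam b) * P a b c := by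
    have : ∑ k, g k * l₂ k = ∑ c, ∑ a, ∑ b, (lam c * lam a + lam c * lam b) * P a b c -
        ∑ c, ∑ a, ∑ b, (lam a * lam b - 1) * P a b c := by
      rw [← e1, ← e2, ← Finset.sum_sub_distrib]
      exact Finset.sum_congr rfl fun k _ => by rw [re2 k]; ring
    rw [this]
    simp only [add_mul, sub_mul, Finset.sum_add_distrib, Finset.sum_sub_distrib, one_mul]
    rw [e4, e3]; ring
  have hn' : (0 : ℝ) < n := by exact_mod_cast hn
  rw [e5, Finset.mul_sum]
  refine Finset.sum_le_sum fun k _ => ?_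
  -- Cauchy–Schwarz is the source of the factor `1/n`, hence of the exponent in `a = V^{1/n}`. Only
  -- the terms `b = a` are needed; the others are nonnegative because `lam ≥ 0`.
  have cs : l₁ k ^ 2 ≤ n * ∑ a, (lam a * g a * T a a k) ^ 2 := by
    rw [re1 k]
    simpa using sq_sum_le_card_mul_sum_sq (s := Finset.univ) (f := fun a => lam a * g a * T a a k)
  calc 1 / n * (g k * l₁ k ^ 2) ≤ 1 / n * (g k * (n * ∑ a, (lam a * g a * T a a k) ^ 2)) := by
        have := (hgpos k).le
        gcongr
    _ = ∑ a, lam a * lam a * P a a k := by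
        rw [Finset.mul_sum, Finset.mul_sum, Finset.mul_sum]
        refine Finset.sum_congr rfl fun a _ => ?_
        simp only [P]; field_simp
    _ ≤ ∑ a, ∑ b, (1 + lam a * lam b) * P a b k := by
        refine Finset.sum_le_sum fun a _ => ?_
        calc lam a * lam a * P a a k ≤ (1 + lam a * lam a) * P a a k := by
              nlinarith [hPnn a a k]
          _ ≤ _ := Finset.single_le_sum (f := fun b => (1 + lam a * lam b) * P a b k)
              (fun b _ => mul_nonneg (by have := mul_nonneg (hlam a) (hlam b); linarith)
                (hPnn a b k)) (Finset.mem_univ a)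

/-! ### The Hessian in an orthonormal frame. -/

section Frames

variable {n : ℕ} {u : EuclideanSpace ℝ (Fin n) → ℝ}

theorem sum_smul_single (v : EuclideanSpace ℝ (Fin n)) :
    ∑ k, v k • EuclideanSpace.single k (1 : ℝ) = v := by
  simpa using (EuclideanSpace.basisFun (Fin n) ℝ).sum_repr v

/-- The Hessian of `u` expressed in an orthonormal frame. -/
noncomputable def frameHessian (b : OrthonormalBasis (Fin n) ℝ (EuclideanSpace ℝ (Fin n)))
    (u : EuclideanSpace ℝ (Fin n) → ℝ) (x : EuclideanSpace ℝ (Fin n)) :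
    Matrix (Fin n) (Fin n) ℝ :=
  Matrix.of fun i j => dirDeriv (b i) (dirDeriv (b j) u) x

theorem frameHessian_eq {U : Set (EuclideanSpace ℝ (Fin n))} (hU : IsOpen U)
    (hu : ContDiffOn ℝ ∞ u U) {x : EuclideanSpace ℝ (Fin n)} (hx : x ∈ U)
    (b : OrthonormalBasis (Fin n) ℝ (EuclideanSpace ℝ (Fin n))) :
    frameHessian b u x = (Matrix.of fun i k => b i k) * hessian u x *
      (Matrix.of fun i k => b i k).transpose := by
  ext i j
  have h := dirDeriv_dirDeriv_sum hU hu hx Finset.univ (fun k => b i k)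
    (fun k => EuclideanSpace.single k (1 : ℝ)) Finset.univ (fun k => b j k)
    (fun k => EuclideanSpace.single k (1 : ℝ))
  rw [sum_smul_single, sum_smul_single] at h
  change dirDeriv (b i) (dirDeriv (b j) u) x = _
  rw [h]
  simp only [Matrix.mul_apply, Matrix.of_apply, Matrix.transpose_apply, Finset.sum_mul]
  rw [Finset.sum_comm]
  refine Finset.sum_congr rfl fun k _ => Finset.sum_congr rfl fun l _ => ?_
  change _ = b i l * dirDeriv (EuclideanSpace.single l 1)
    (dirDeriv (EuclideanSpace.single k 1) u) x * b j k
  ring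

theorem frameMatrix_mul_transpose (b : OrthonormalBasis (Fin n) ℝ (EuclideanSpace ℝ (Fin n))) :
    (Matrix.of fun i k => b i k) * (Matrix.of fun i k => b i k).transpose = 1 := by
  ext i j
  have h := orthonormal_iff_ite.1 b.orthonormal j i
  simp only [Matrix.mul_apply, Matrix.of_apply, Matrix.transpose_apply, Matrix.one_apply]
  rw [PiLp.inner_apply] at h
  simp only [RCLike.inner_apply, conj_trivial] at h
  rw [h]
  simp [eq_comm]

theorem det_one_add_smul_frameHessian {U : Set (EuclideanSpace ℝ (Fin n))} (hU : IsOpen U)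
    (hu : ContDiffOn ℝ ∞ u U) {x : EuclideanSpace ℝ (Fin n)} (hx : x ∈ U)
    (b : OrthonormalBasis (Fin n) ℝ (EuclideanSpace ℝ (Fin n))) (z : ℂ) :
    (1 + z • (frameHessian b u x).map Complex.ofReal).det =
      (1 + z • (hessian u x).map Complex.ofReal).det := by
  rw [frameHessian_eq hU hu hx b]
  set Q : Matrix (Fin n) (Fin n) ℝ := Matrix.of fun i k => b i k with hQ
  have hQQ : Q * Q.transpose = 1 := frameMatrix_mul_transpose b
  have hmap : ∀ A B : Matrix (Fin n) (Fin n) ℝ,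
      (A * B).map Complex.ofReal = A.map Complex.ofReal * B.map Complex.ofReal :=
    fun A B => Matrix.map_mul (f := Complex.ofRealHom)
  have hPQ : Q.map Complex.ofReal * Q.transpose.map Complex.ofReal = 1 := by
    rw [← hmap, hQQ, Matrix.map_one _ Complex.ofReal_zero Complex.ofReal_one]
  have h4 : 1 + z • (Q * hessian u x * Q.transpose).map Complex.ofReal =
      Q.map Complex.ofReal * (1 + z • (hessian u x).map Complex.ofReal) *
        Q.transpose.map Complex.ofReal := by
    rw [Matrix.mul_add, Matrix.add_mul, mul_one, hPQ, hmap, hmap]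
    simp
  rw [h4, Matrix.det_mul, Matrix.det_mul, mul_right_comm, ← Matrix.det_mul, hPQ, Matrix.det_one,
    one_mul]

theorem frameHessian_eigenvectorBasis {U : Set (EuclideanSpace ℝ (Fin n))} (hU : IsOpen U)
    (hu : ContDiffOn ℝ ∞ u U) {x : EuclideanSpace ℝ (Fin n)} (hx : x ∈ U)
    (hH : (hessian u x).IsHermitian) :
    frameHessian hH.eigenvectorBasis u x = Matrix.diagonal hH.eigenvalues := by
  rw [frameHessian_eq hU hu hx, Matrix.mul_assoc]
  have h1 : hessian u x * (Matrix.of fun i k => hH.eigenvectorBasis i k).transpose =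
      (Matrix.of fun i k => hH.eigenvectorBasis i k).transpose *
        Matrix.diagonal hH.eigenvalues := by
    ext k j
    have := congrFun (hH.mulVec_eigenvectorBasis j) k
    simp only [Matrix.mulVec, dotProduct, Pi.smul_apply, smul_eq_mul] at this
    rw [Matrix.mul_diagonal, Matrix.mul_apply]
    simp only [Matrix.transpose_apply, Matrix.of_apply]
    rw [this, mul_comm]
  rw [h1, ← Matrix.mul_assoc, frameMatrix_mul_transpose, one_mul]

end Frames

/-! ### Derivatives of `log V` and the Jacobi inequality for solutions. -/

section LogVolume

variable {n : ℕ} {u : EuclideanSpace ℝ (Fin n) → ℝ} {U : Set (EuclideanSpace ℝ (Fin n))}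

theorem contDiffOn_hessian_apply (hU : IsOpen U) (hu : ContDiffOn ℝ ∞ u U) (i j : Fin n) :
    ContDiffOn ℝ ∞ (fun x => hessian u x i j) U :=
  contDiffOn_dirDeriv hU (contDiffOn_dirDeriv hU hu _) _

theorem contDiffOn_volDensity (hU : IsOpen U) (hu : ContDiffOn ℝ ∞ u U)
    (hH : ∀ x ∈ U, (hessian u x).IsHermitian) :
    ContDiffOn ℝ ∞ (fun x => volDensity (hessian u x)) U := by
  have h1 : ContDiffOn ℝ ∞ (fun x => (1 + hessian u x ^ 2).det) U := by
    simp only [Matrix.det_apply']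
    refine ContDiffOn.sum fun σ _ => contDiffOn_const.mul (contDiffOn_prod fun i _ => ?_)
    simp only [Matrix.add_apply, sq, Matrix.mul_apply]
    exact contDiffOn_const.add (ContDiffOn.sum fun k _ =>
      (contDiffOn_hessian_apply hU hu _ _).mul (contDiffOn_hessian_apply hU hu _ _))
  refine h1.sqrt fun x hx => ?_
  rw [det_one_add_sq_eq_prod (hH x hx)]
  exact ne_of_gt (Finset.prod_pos fun i _ => by positivity)

/-- The logarithm of the volume density along `u`. -/
noncomputable def logVol (u : EuclideanSpace ℝ (Fin n) → ℝ) (x : EuclideanSpace ℝ (Fin n)) : ℝ :=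
  Real.log (volDensity (hessian u x))

theorem contDiffOn_logVol (hU : IsOpen U) (hu : ContDiffOn ℝ ∞ u U)
    (hH : ∀ x ∈ U, (hessian u x).IsHermitian) : ContDiffOn ℝ ∞ (logVol u) U :=
  (contDiffOn_volDensity hU hu hH).log fun x hx =>
    (zero_lt_one.trans_le (one_le_volDensity (hH x hx))).ne'

/-- The identity `exp(-iΘ) det(I + i D²u) = exp(log V)` is differentiated twice along `b k`. The
frame is fixed and diagonalizes the Hessian only at `x`, which suffices because the determinant does
not depend on the frame. -/
theorem logVol_derivatives {Θ : ℝ} (hU : IsOpen U) (hu : ContDiffOn ℝ ∞ u U)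
    (hs : SolvesSLag Θ U u) {x : EuclideanSpace ℝ (Fin n)} (hx : x ∈ U)
    (b : OrthonormalBasis (Fin n) ℝ (EuclideanSpace ℝ (Fin n))) {lam : Fin n → ℝ}
    (hb : frameHessian b u x = Matrix.diagonal lam) (k : Fin n) :
    (dirDeriv (b k) (logVol u) x : ℂ) = ∑ a, (1 + Complex.I * lam a)⁻¹ *
        (Complex.I * dirDeriv (b k) (dirDeriv (b a) (dirDeriv (b a) u)) x) ∧
      (dirDeriv (b k) (dirDeriv (b k) (logVol u)) x : ℂ) =
        ∑ a, (1 + Complex.I * lam a)⁻¹ * (Complex.I *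
          dirDeriv (b k) (dirDeriv (b k) (dirDeriv (b a) (dirDeriv (b a) u))) x) -
        ∑ a, ∑ c, (1 + Complex.I * lam a)⁻¹ *
            (Complex.I * dirDeriv (b k) (dirDeriv (b a) (dirDeriv (b c) u)) x) *
          ((1 + Complex.I * lam c)⁻¹ *
            (Complex.I * dirDeriv (b k) (dirDeriv (b c) (dirDeriv (b a) u)) x)) := by
  have hH : ∀ x ∈ U, (hessian u x).IsHermitian := fun x hx => (hs x hx).1
  have hsm := contDiffOn_logVol hU hu hH
  have hev := eventually_line_mem hU hx (b k)
  have hx0 : x + (0 : ℝ) • b k ∈ U := by simpa using hx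
  have sm2 : ∀ i j, ContDiffOn ℝ ∞ (dirDeriv (b i) (dirDeriv (b j) u)) U := fun i j =>
    contDiffOn_dirDeriv hU (contDiffOn_dirDeriv hU hu _) _
  let M : ℝ → Matrix (Fin n) (Fin n) ℂ := fun t =>
    1 + Complex.I • (frameHessian b u (x + t • b k)).map Complex.ofReal
  let M₁ : ℝ → Matrix (Fin n) (Fin n) ℂ := fun t => Matrix.of fun i j =>
    Complex.I * (dirDeriv (b k) (dirDeriv (b i) (dirDeriv (b j) u)) (x + t • b k) : ℂ)
  let M₂ : Matrix (Fin n) (Fin n) ℂ := Matrix.of fun i j =>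
    Complex.I * (dirDeriv (b k) (dirDeriv (b k) (dirDeriv (b i) (dirDeriv (b j) u))) x : ℂ)
  have key := log_det_derivatives (M := M) (M₁ := M₁) (M₂ := M₂)
    (l := fun t => logVol u (x + t • b k))
    (l₁ := fun t => dirDeriv (b k) (logVol u) (x + t • b k))
    (l₂ := dirDeriv (b k) (dirDeriv (b k) (logVol u)) x)
    (Complex.exp (-(Θ * Complex.I)))
    (hev.mono fun t ht i j =>
      ((hasDerivAt_line hU (sm2 i j) ht).ofReal_comp.const_mul Complex.I).const_add _)
    (fun i j => by
      have := ((hasDerivAt_line hU (contDiffOn_dirDeriv hU (sm2 i j) (b k))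
        hx0).ofReal_comp.const_mul Complex.I)
      simp only [zero_smul, add_zero] at this
      exact this)
    (hev.mono fun t ht => hasDerivAt_line hU hsm ht)
    (by simpa using hasDerivAt_line hU (contDiffOn_dirDeriv hU hsm (b k)) hx0)
    (hev.mono fun t ht => by
      obtain ⟨h1, h2⟩ := hs _ ht
      change _ * (1 + Complex.I • (frameHessian b u (x + t • b k)).map Complex.ofReal).det = _
      rw [det_one_add_smul_frameHessian hU hu ht, exp_neg_mul_det_eq_volDensity h1 h2, logVol,
        Real.exp_log (zero_lt_one.trans_le (one_le_volDensity h1))])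
  have hne : ∀ a, 1 + Complex.I * (lam a : ℂ) ≠ 0 := fun a h => by
    have := congrArg Complex.re h
    simp at this
  have hM0 : (M 0)⁻¹ = Matrix.diagonal fun a => (1 + Complex.I * (lam a : ℂ))⁻¹ := by
    have h1 : M 0 = Matrix.diagonal fun a => 1 + Complex.I * (lam a : ℂ) := by
      simp only [M, zero_smul, add_zero, hb]
      rw [Matrix.diagonal_map Complex.ofReal_zero, ← Matrix.diagonal_one, ← Matrix.diagonal_smul,
        Matrix.diagonal_add]
      rfl
    rw [h1]
    refine Matrix.inv_eq_left_inv ?_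
    rw [Matrix.diagonal_mul_diagonal, ← Matrix.diagonal_one]
    congr 1
    funext a
    exact inv_mul_cancel₀ (hne a)
  rw [hM0] at key
  have hM₁ : M₁ 0 = Matrix.of fun i j =>
      Complex.I * (dirDeriv (b k) (dirDeriv (b i) (dirDeriv (b j) u)) x : ℂ) := by
    simp [M₁]
  rw [hM₁] at key
  simp only [zero_smul, add_zero] at key
  refine ⟨?_, ?_⟩
  · rw [key.1]
    simp [Matrix.trace]
  · rw [key.2]
    congr 1
    · simp [Matrix.trace, M₂]
    · simp [Matrix.trace, Matrix.mul_apply (M := _ * _)]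

theorem hessian_diagonal_nonneg {u : EuclideanSpace ℝ (Fin n) → ℝ} (hU : IsOpen U)
    (hu : ContDiffOn ℝ ∞ u U) (hc : ConvexOn ℝ U u) {x : EuclideanSpace ℝ (Fin n)} (hx : x ∈ U)
    (v : EuclideanSpace ℝ (Fin n)) : 0 ≤ dirDeriv v (dirDeriv v u) x := by
  have hev := eventually_line_mem hU hx v
  have hx0 : x + (0 : ℝ) • v ∈ U := by simpa using hx
  -- Subtracting the tangent line turns convexity into a minimum at `0`.
  refine second_deriv_nonneg_of_isLocalMin (a := 0)
    (f := fun t => u (x + t • v) - t * dirDeriv v u x)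
    (f' := fun t => dirDeriv v u (x + t • v) - dirDeriv v u x) ?_ ?_ ?_
  · filter_upwards [hev] with t ht
    exact ((hasDerivAt_line hU hu ht).fun_sub
      ((hasDerivAt_id' t).mul_const (dirDeriv v u x))).congr_deriv (by simp)
  · simpa using (hasDerivAt_line hU (contDiffOn_dirDeriv hU hu v) hx0).sub_const
      (dirDeriv v u x)
  · filter_upwards [hev] with t ht
    have := convexOn_tangent_le hc hx ht (differentiableAt_of_contDiffOn hU hu hx)
    simp only [add_sub_cancel_left, map_smul, smul_eq_mul] at this
    simp only [zero_smul, add_zero, zero_mul, sub_zero, dirDeriv]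
    linarith

/-- In an eigenframe of the Hessian at `x`, the linearized equation for the first derivatives and
the Jacobi inequality for the logarithm of the volume density hold. -/
theorem exists_eigenframe (hn : 1 ≤ n) {Θ : ℝ} (hU : IsOpen U)
    (hu : ContDiffOn ℝ ∞ u U) (hc : ConvexOn ℝ U u) (hs : SolvesSLag Θ U u)
    {x : EuclideanSpace ℝ (Fin n)} (hx : x ∈ U) :
    ∃ (b : OrthonormalBasis (Fin n) ℝ (EuclideanSpace ℝ (Fin n))) (lam : Fin n → ℝ),
      (∀ i, 0 ≤ lam i) ∧
      (∀ i j, dirDeriv (b i) (dirDeriv (b j) u) x = if i = j then lam i else 0) ∧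
      (∀ j, ∑ k, (1 + lam k ^ 2)⁻¹ *
        dirDeriv (b k) (dirDeriv (b k) (dirDeriv (b j) u)) x = 0) ∧
      1 / n * ∑ k, (1 + lam k ^ 2)⁻¹ * dirDeriv (b k) (logVol u) x ^ 2 ≤
        ∑ k, (1 + lam k ^ 2)⁻¹ * dirDeriv (b k) (dirDeriv (b k) (logVol u)) x := by
  have hH := (hs x hx).1
  have hfr := frameHessian_eigenvectorBasis hU hu hx hH
  set b := hH.eigenvectorBasis
  set lam := hH.eigenvalues
  have hbij : ∀ i j, dirDeriv (b i) (dirDeriv (b j) u) x = if i = j then lam i else 0 := by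
    intro i j
    have := congrFun (congrFun hfr i) j
    rwa [Matrix.diagonal_apply] at this
  have hlam : ∀ i, 0 ≤ lam i := fun i => by
    have := hessian_diagonal_nonneg hU hu hc hx (b i)
    rwa [hbij, if_pos rfl] at this
  have sm1 : ∀ j, ContDiffOn ℝ ∞ (dirDeriv (b j) u) U := fun j => contDiffOn_dirDeriv hU hu _
  have sm2 : ∀ i j, ContDiffOn ℝ ∞ (dirDeriv (b i) (dirDeriv (b j) u)) U := fun i j =>
    contDiffOn_dirDeriv hU (sm1 j) _
  have c2 : ∀ i j, Set.EqOn (dirDeriv (b i) (dirDeriv (b j) u)) (dirDeriv (b j) (dirDeriv (b i) u))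
      U := fun i j z hz => dirDeriv_comm hU hu hz _ _
  have c3 : ∀ i j k, Set.EqOn (dirDeriv (b i) (dirDeriv (b j) (dirDeriv (b k) u)))
      (dirDeriv (b j) (dirDeriv (b i) (dirDeriv (b k) u))) U :=
    fun i j k z hz => dirDeriv_comm hU (sm1 k) hz _ _
  have c3' : ∀ i j k, Set.EqOn (dirDeriv (b i) (dirDeriv (b j) (dirDeriv (b k) u)))
      (dirDeriv (b i) (dirDeriv (b k) (dirDeriv (b j) u))) U :=
    fun i j k z hz => dirDeriv_congr hU (c2 j k) hz _
  have key := jacobi_algebra hn (lam := lam)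
    (l₁ := fun k => dirDeriv (b k) (logVol u) x)
    (l₂ := fun k => dirDeriv (b k) (dirDeriv (b k) (logVol u)) x)
    (T := fun a c k => dirDeriv (b k) (dirDeriv (b a) (dirDeriv (b c) u)) x)
    (F := fun a k => dirDeriv (b k) (dirDeriv (b k) (dirDeriv (b a) (dirDeriv (b a) u))) x)
    hlam (fun a c k => c3' k a c hx) (fun a c k => c3 k a c hx)
    (fun a k => by
      calc dirDeriv (b k) (dirDeriv (b k) (dirDeriv (b a) (dirDeriv (b a) u))) x
          = dirDeriv (b k) (dirDeriv (b a) (dirDeriv (b k) (dirDeriv (b a) u))) x :=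
            dirDeriv_congr hU (c3 k a a) hx _
        _ = dirDeriv (b a) (dirDeriv (b k) (dirDeriv (b k) (dirDeriv (b a) u))) x :=
            dirDeriv_comm hU (sm2 k a) hx _ _
        _ = dirDeriv (b a) (dirDeriv (b k) (dirDeriv (b a) (dirDeriv (b k) u))) x :=
            dirDeriv_congr hU (c3' k k a) hx _
        _ = dirDeriv (b a) (dirDeriv (b a) (dirDeriv (b k) (dirDeriv (b k) u))) x :=
            dirDeriv_congr hU (c3 k a k) hx _)
    (fun k => (logVol_derivatives hU hu hs hx b hfr k).1)
    (fun k => (logVol_derivatives hU hu hs hx b hfr k).2)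
  refine ⟨b, lam, hlam, hbij, fun j => ?_, key.2⟩
  rw [← key.1 j]
  refine Finset.sum_congr rfl fun k _ => ?_
  rw [c3' k k j hx, c3 k j k hx]

end LogVolume

/-! ### The barrier and the comparison principle. -/

section Barrier

variable {n : ℕ} {u : EuclideanSpace ℝ (Fin n) → ℝ} {U : Set (EuclideanSpace ℝ (Fin n))}

/-- The half squared distance to `y` plus the height of the graph at `y` above the tangent plane
at `x`. -/
noncomputable def barrier (u : EuclideanSpace ℝ (Fin n) → ℝ) (y x : EuclideanSpace ℝ (Fin n)) : ℝ :=
  ‖x - y‖ ^ 2 / 2 + (u y - u x + fderiv ℝ u x (x - y))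

theorem half_sq_le_barrier (hU : IsOpen U) (hu : ContDiffOn ℝ ∞ u U) (hc : ConvexOn ℝ U u)
    {x y : EuclideanSpace ℝ (Fin n)} (hx : x ∈ U) (hy : y ∈ U) :
    ‖x - y‖ ^ 2 / 2 ≤ barrier u y x := by
  have := convexOn_tangent_le hc hx hy (differentiableAt_of_contDiffOn hU hu hx)
  rw [← neg_sub x y, map_neg] at this
  unfold barrier
  linarith

theorem barrier_eq_sum (b : OrthonormalBasis (Fin n) ℝ (EuclideanSpace ℝ (Fin n)))
    (y x : EuclideanSpace ℝ (Fin n)) :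
    barrier u y x = ‖x - y‖ ^ 2 / 2 +
      (u y - u x + ∑ j, inner ℝ (b j) (x - y) * dirDeriv (b j) u x) := by
  unfold barrier
  congr 2
  conv_lhs => rw [← b.sum_repr (x - y)]
  simp only [dirDeriv, b.repr_apply_apply, map_sum, map_smul, smul_eq_mul]

theorem hasDerivAt_inner_line (v w x y : EuclideanSpace ℝ (Fin n)) (t : ℝ) :
    HasDerivAt (fun s : ℝ => inner ℝ w (x + s • v - y)) (inner ℝ w v) t := by
  have h : (fun s : ℝ => inner ℝ w (x + s • v - y)) =
      fun s : ℝ => inner ℝ w (x - y) + s * inner ℝ w v := by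
    funext s
    rw [add_sub_right_comm, inner_add_right, inner_smul_right]
  rw [h]
  simpa using ((hasDerivAt_id' t).mul_const (inner ℝ w v : ℝ)).const_add (inner ℝ w (x - y) : ℝ)

theorem hasDerivAt_norm_sq_line (v x y : EuclideanSpace ℝ (Fin n)) (t : ℝ) :
    HasDerivAt (fun s : ℝ => ‖x + s • v - y‖ ^ 2 / 2) (inner ℝ v (x + t • v - y)) t := by
  have h : HasDerivAt (fun s : ℝ => x + s • v - y) v t := by
    simpa using (((hasDerivAt_id t).smul_const v).const_add x).sub_const y
  refine (h.norm_sq.div_const 2).congr_deriv ?_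
  rw [real_inner_comm]
  ring

/-- The first-order terms in `u` cancel: `-∂_k u` against the derivative of the factor `x - y`. -/
theorem barrier_hasDerivAt (hU : IsOpen U) (hu : ContDiffOn ℝ ∞ u U)
    (b : OrthonormalBasis (Fin n) ℝ (EuclideanSpace ℝ (Fin n)))
    {x y : EuclideanSpace ℝ (Fin n)} (k : Fin n) {t : ℝ} (ht : x + t • b k ∈ U) :
    HasDerivAt (fun s : ℝ => barrier u y (x + s • b k))
      (inner ℝ (b k) (x + t • b k - y) + ∑ j, inner ℝ (b j) (x + t • b k - y) *
        dirDeriv (b k) (dirDeriv (b j) u) (x + t • b k)) t := by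
  simp only [barrier_eq_sum b]
  have h := (hasDerivAt_norm_sq_line (b k) x y t).fun_add
    (((hasDerivAt_line hU hu ht).const_sub (u y)).fun_add
      (HasDerivAt.fun_sum (u := Finset.univ) fun j _ =>
        (hasDerivAt_inner_line (b k) (b j) x y t).fun_mul
          (hasDerivAt_line hU (contDiffOn_dirDeriv hU hu (b j)) ht)))
  refine h.congr_deriv ?_
  rw [Finset.sum_add_distrib]
  simp [orthonormal_iff_ite.1 b.orthonormal]

theorem barrier_hasDerivAt_second (hU : IsOpen U) (hu : ContDiffOn ℝ ∞ u U)
    (b : OrthonormalBasis (Fin n) ℝ (EuclideanSpace ℝ (Fin n)))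
    {x y : EuclideanSpace ℝ (Fin n)} (hx : x ∈ U) (k : Fin n) :
    HasDerivAt (fun t : ℝ => inner ℝ (b k) (x + t • b k - y) + ∑ j,
        inner ℝ (b j) (x + t • b k - y) * dirDeriv (b k) (dirDeriv (b j) u) (x + t • b k))
      (1 + dirDeriv (b k) (dirDeriv (b k) u) x + ∑ j, inner ℝ (b j) (x - y) *
        dirDeriv (b k) (dirDeriv (b k) (dirDeriv (b j) u)) x) 0 := by
  have hx0 : x + (0 : ℝ) • b k ∈ U := by simpa using hx
  have h := (hasDerivAt_inner_line (b k) (b k) x y 0).fun_add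
    (HasDerivAt.fun_sum (u := Finset.univ) fun j _ =>
      (hasDerivAt_inner_line (b k) (b j) x y 0).fun_mul
        (hasDerivAt_line hU (contDiffOn_dirDeriv hU (contDiffOn_dirDeriv hU hu (b j)) (b k)) hx0))
  refine h.congr_deriv ?_
  rw [Finset.sum_add_distrib]
  simp [orthonormal_iff_ite.1 b.orthonormal, add_assoc]

/-- A positive multiple of `exp (-K * barrier)` cannot touch `V^{-1/n}` from below away from the
ball of radius `√(2n / K)`. -/
theorem not_isLocalMin_comparison (hn : 1 ≤ n) {Θ : ℝ} (hU : IsOpen U) (hu : ContDiffOn ℝ ∞ u U)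
    (hc : ConvexOn ℝ U u) (hs : SolvesSLag Θ U u) {x y : EuclideanSpace ℝ (Fin n)} (hx : x ∈ U)
    {K m c : ℝ} (hK : 0 < K) (hm : 0 < m) (hxy : 2 * n < K * ‖x - y‖ ^ 2) :
    ¬ IsLocalMin (fun z => Real.exp (-(1 / n) * logVol u z) -
      m * (Real.exp (-K * barrier u y z) - c)) x := by
  intro hmin
  obtain ⟨b, lam, hlam, hbij, hlin, hjac⟩ := exists_eigenframe hn hU hu hc hs hx
  have hn' : (0 : ℝ) < n := by exact_mod_cast hn
  have hsm := contDiffOn_logVol hU hu fun z hz => (hs z hz).1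
  set w : Fin n → ℝ := fun j => inner ℝ (b j) (x - y) with hw
  set g : Fin n → ℝ := fun k => (1 + lam k ^ 2)⁻¹ with hg
  have hgpos : ∀ k, 0 < g k := fun k => by simp only [hg]; positivity
  set l₁ : Fin n → ℝ := fun k => dirDeriv (b k) (logVol u) x with hl₁
  set l₂ : Fin n → ℝ := fun k => dirDeriv (b k) (dirDeriv (b k) (logVol u)) x with hl₂
  set S : Fin n → ℝ := fun k => ∑ j, w j *
    dirDeriv (b k) (dirDeriv (b k) (dirDeriv (b j) u)) x with hS
  set e := Real.exp (-(1 / n) * logVol u x) with he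
  set d := Real.exp (-K * barrier u y x) with hd
  -- Second-derivative test at the minimum along each frame direction. Weighted by `g k` and summed,
  -- it bounds `L` of the difference below by `0`.
  have hsecond : ∀ k, 0 ≤ e * (-(1 / n) * l₂ k + (-(1 / n) * l₁ k) ^ 2) -
      m * (d * (-K * (1 + lam k + S k) + (-K * (w k * (1 + lam k))) ^ 2)) := by
    intro k
    have hev := eventually_line_mem hU hx (b k)
    have hx0 : x + (0 : ℝ) • b k ∈ U := by simpa using hx
    let p₁ : ℝ → ℝ := fun t => -(1 / n) * dirDeriv (b k) (logVol u) (x + t • b k)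
    let q₁ : ℝ → ℝ := fun t => -K * (inner ℝ (b k) (x + t • b k - y) + ∑ j,
        inner ℝ (b j) (x + t • b k - y) * dirDeriv (b k) (dirDeriv (b j) u) (x + t • b k))
    have hp : ∀ t, x + t • b k ∈ U →
        HasDerivAt (fun s : ℝ => -(1 / n) * logVol u (x + s • b k)) (p₁ t) t := fun t ht =>
      (hasDerivAt_line hU hsm ht).const_mul _
    have hq : ∀ t, x + t • b k ∈ U →
        HasDerivAt (fun s : ℝ => -K * barrier u y (x + s • b k)) (q₁ t) t := fun t ht =>
      (barrier_hasDerivAt hU hu b k ht).const_mul _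
    have hp₁ : HasDerivAt p₁ (-(1 / n) * l₂ k) 0 := by
      have := (hasDerivAt_line hU (contDiffOn_dirDeriv hU hsm (b k)) hx0).const_mul (-(1 / n : ℝ))
      simp only [zero_smul, add_zero] at this
      exact this
    have hq₁ : HasDerivAt q₁ (-K * (1 + lam k + S k)) 0 := by
      have := (barrier_hasDerivAt_second (y := y) hU hu b hx k).const_mul (-K)
      rw [hbij, if_pos rfl] at this
      exact this
    have hp0 : p₁ 0 = -(1 / n) * l₁ k := by simp [p₁, hl₁]
    have hq0 : q₁ 0 = -K * (w k * (1 + lam k)) := by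
      simp only [q₁, zero_smul, add_zero, hbij, hw]
      simp [mul_add]
    refine second_deriv_nonneg_of_isLocalMin (a := 0)
      (f := fun t : ℝ => Real.exp (-(1 / n) * logVol u (x + t • b k)) -
        m * (Real.exp (-K * barrier u y (x + t • b k)) - c))
      (f' := fun t => Real.exp (-(1 / n) * logVol u (x + t • b k)) * p₁ t -
        m * (Real.exp (-K * barrier u y (x + t • b k)) * q₁ t)) ?_ ?_ ?_
    · filter_upwards [hev] with t ht
      exact (hp t ht).exp.fun_sub (((hq t ht).exp.sub_const c).const_mul m)
    · have h1 := hasDerivAt_exp_comp_second (hp 0 hx0) hp₁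
      have h2 := hasDerivAt_exp_comp_second (hq 0 hx0) hq₁
      refine (h1.fun_sub (h2.const_mul m)).congr_deriv ?_
      rw [hp0, hq0]
      simp only [zero_smul, add_zero, he, hd]
    · have hcont : ContinuousAt (fun t : ℝ => x + t • b k) 0 := by fun_prop
      have hmin' : IsLocalMin (fun z => Real.exp (-(1 / n) * logVol u z) -
          m * (Real.exp (-K * barrier u y z) - c)) (x + (0 : ℝ) • b k) := by simpa using hmin
      exact IsMinFilter.comp_tendsto (g := fun t : ℝ => x + t • b k) hmin' hcont
  have hsum : 0 ≤ ∑ k, g k * (e * (-(1 / n) * l₂ k + (-(1 / n) * l₁ k) ^ 2) -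
      m * (d * (-K * (1 + lam k + S k) + (-K * (w k * (1 + lam k))) ^ 2))) :=
    Finset.sum_nonneg fun k _ => mul_nonneg (hgpos k).le (hsecond k)
  -- The third derivatives of `u` drop out by the linearized equation; no bound on them is needed.
  have hSzero : ∑ k, g k * S k = 0 := by
    simp only [hS, Finset.mul_sum]
    rw [Finset.sum_comm]
    refine Finset.sum_eq_zero fun j _ => ?_
    have := hlin j
    calc ∑ k, g k * (w j * dirDeriv (b k) (dirDeriv (b k) (dirDeriv (b j) u)) x)
        = w j * ∑ k, g k * dirDeriv (b k) (dirDeriv (b k) (dirDeriv (b j) u)) x := by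
          rw [Finset.mul_sum]; exact Finset.sum_congr rfl fun k _ => by ring
      _ = 0 := by rw [this, mul_zero]
  have hsplit : ∑ k, g k * (e * (-(1 / n) * l₂ k + (-(1 / n) * l₁ k) ^ 2) -
      m * (d * (-K * (1 + lam k + S k) + (-K * (w k * (1 + lam k))) ^ 2))) =
      e * (1 / n) * (1 / n * ∑ k, g k * l₁ k ^ 2 - ∑ k, g k * l₂ k) +
      m * d * K * (∑ k, g k * S k) -
      m * d * K * (∑ k, (K * (g k * (w k * (1 + lam k)) ^ 2) - g k * (1 + lam k))) := by
    simp only [Finset.mul_sum, ← Finset.sum_sub_distrib, ← Finset.sum_add_distrib]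
    exact Finset.sum_congr rfl fun k _ => by ring
  have hwsum : ∑ k, w k ^ 2 = ‖x - y‖ ^ 2 := by
    simpa [hw, sq_abs] using b.sum_sq_norm_inner_right (x - y)
  have hpos : 0 < ∑ k, (K * (g k * (w k * (1 + lam k)) ^ 2) - g k * (1 + lam k)) := by
    -- Uses `(1 + lam)² ≥ 1 + lam²`, valid for `lam ≥ 0`, and `1 + lam ≤ 2 (1 + lam²)`. Both are
    -- uniform in the size of the Hessian.
    have h1 : ∀ k, K * w k ^ 2 - 2 ≤ K * (g k * (w k * (1 + lam k)) ^ 2) - g k * (1 + lam k) := by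
      intro k
      have hl := hlam k
      have hgm : g k * (1 + lam k ^ 2) = 1 := inv_mul_cancel₀ (by positivity)
      have h2 : w k ^ 2 ≤ g k * (w k * (1 + lam k)) ^ 2 := by
        calc w k ^ 2 = g k * (1 + lam k ^ 2) * w k ^ 2 := by rw [hgm, one_mul]
          _ ≤ g k * (1 + lam k) ^ 2 * w k ^ 2 := by
            have := (hgpos k).le
            gcongr
            nlinarith
          _ = _ := by ring
      have h3 : g k * (1 + lam k) ≤ 2 := by
        calc g k * (1 + lam k) ≤ g k * (2 * (1 + lam k ^ 2)) := by
              have := (hgpos k).le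
              gcongr
              nlinarith [sq_nonneg (lam k - 1)]
          _ = 2 := by linear_combination 2 * hgm
      have := mul_le_mul_of_nonneg_left h2 hK.le
      linarith
    have h2 := Finset.sum_le_sum fun k (_ : k ∈ Finset.univ) => h1 k
    rw [Finset.sum_sub_distrib, ← Finset.mul_sum, hwsum] at h2
    simp only [Finset.sum_const, Finset.card_univ, Fintype.card_fin, nsmul_eq_mul] at h2
    linarith
  rw [hsplit, hSzero] at hsum
  have hepos : 0 < e := Real.exp_pos _
  have hdpos : 0 < d := Real.exp_pos _
  have h1 : e * (1 / n) * (1 / n * ∑ k, g k * l₁ k ^ 2 - ∑ k, g k * l₂ k) ≤ 0 :=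
    mul_nonpos_of_nonneg_of_nonpos (by positivity) (sub_nonpos.2 hjac)
  have h2 := mul_pos (mul_pos (mul_pos hm hdpos) hK) hpos
  linarith

end Barrier

/-! ### The doubling inequality and the Hessian bound. -/

section Doubling

variable {n : ℕ} {u : EuclideanSpace ℝ (Fin n) → ℝ} {Θ : ℝ}

theorem jacobiFun_eq_exp {U : Set (EuclideanSpace ℝ (Fin n))} (hs : SolvesSLag Θ U u)
    {x : EuclideanSpace ℝ (Fin n)} (hx : x ∈ U) :
    jacobiFun (hessian u x) = Real.exp (1 / n * logVol u x) := by
  have := one_le_volDensity (hs x hx).1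
  rw [jacobiFun, Real.rpow_def_of_pos (by linarith), mul_comm]
  rfl

theorem lipschitzOnWith_of_c01Norm_le {A : ℝ≥0} {Ω : Set (EuclideanSpace ℝ (Fin n))}
    (h : c01Norm Ω u ≤ (A : ℝ≥0∞)) : LipschitzOnWith A u Ω := by
  intro x hx y hy
  by_cases hxy : x = y
  · simp [hxy]
  have h1 : edist (u x) (u y) / edist x y ≤ (A : ℝ≥0∞) := by
    refine le_trans ?_ (le_trans le_add_self h)
    exact le_iSup₂_of_le x hx (le_iSup₂_of_le y hy (le_iSup_of_le hxy le_rfl))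
  rwa [ENNReal.div_le_iff (by simpa using hxy) (edist_ne_top x y)] at h1

theorem barrier_le {A : ℝ≥0} {Ω : Set (EuclideanSpace ℝ (Fin n))} (hΩ : IsOpen Ω)
    (hL : LipschitzOnWith A u Ω) {x y : EuclideanSpace ℝ (Fin n)} (hx : x ∈ Ω) (hy : y ∈ Ω) :
    barrier u y x ≤ ‖x - y‖ ^ 2 / 2 + 2 * A * ‖x - y‖ := by
  have h1 : u y - u x ≤ A * ‖x - y‖ := by
    have := hL.dist_le_mul y hy x hx
    rw [Real.dist_eq, dist_comm, dist_eq_norm] at this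
    exact (le_abs_self _).trans this
  have h2 : fderiv ℝ u x (x - y) ≤ A * ‖x - y‖ :=
    (le_abs_self _).trans (((fderiv ℝ u x).le_opNorm _).trans (mul_le_mul_of_nonneg_right
      (norm_fderiv_le_of_lipschitzOn ℝ (hΩ.mem_nhds hx) hL) (norm_nonneg _)))
  unfold barrier
  linarith

theorem continuousOn_barrier {U : Set (EuclideanSpace ℝ (Fin n))} (hU : IsOpen U)
    (hu : ContDiffOn ℝ ∞ u U) (y : EuclideanSpace ℝ (Fin n)) :
    ContinuousOn (barrier u y) U := by
  have h1 := hu.continuousOn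
  have h2 : ContinuousOn (fderiv ℝ u) U := hu.continuousOn_fderiv_of_isOpen hU (by simp)
  unfold barrier
  have h3 : ContinuousOn (fun x => fderiv ℝ u x (x - y)) U :=
    h2.clm_apply (by fun_prop)
  have h4 : ContinuousOn (fun x : EuclideanSpace ℝ (Fin n) => ‖x - y‖ ^ 2 / 2) U := by fun_prop
  exact h4.add ((continuousOn_const.sub h1).add h3)

/-- The radius of the doubling inequality for Lipschitz bound `A`. -/
noncomputable def doublingRadius (A : ℝ≥0) : ℝ := 1 / (32 * (1 + A))

/-- The reciprocal of the doubling constant. -/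
noncomputable def doublingGap (n : ℕ) (A : ℝ≥0) (r : ℝ) : ℝ :=
  -- The first exponent contains the upper bound `barrier_le` on the ball of radius `doublingRadius
  -- A`; `1/8 = (1/2)²/2` is the lower bound for the barrier on the sphere of radius `1/2`.
  Real.exp (-((2 * n + 1) / r ^ 2) * (doublingRadius A ^ 2 / 2 + 2 * A * doublingRadius A)) -
    Real.exp (-((2 * n + 1) / r ^ 2) * (1 / 8))

theorem doublingRadius_pos (A : ℝ≥0) : 0 < doublingRadius A := by
  unfold doublingRadius
  positivity

theorem doublingRadius_le (A : ℝ≥0) : doublingRadius A ≤ 1 / 32 := by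
  unfold doublingRadius
  have : (0 : ℝ) ≤ A := A.2
  exact one_div_le_one_div_of_le (by norm_num) (by linarith)

theorem mul_doublingRadius_le (A : ℝ≥0) : A * doublingRadius A ≤ 1 / 32 := by
  have : (0 : ℝ) ≤ A := A.2
  unfold doublingRadius
  rw [mul_one_div, div_le_div_iff₀ (by positivity) (by norm_num)]
  linarith

theorem doublingGap_pos (n : ℕ) (A : ℝ≥0) {r : ℝ} (hr : 0 < r) : 0 < doublingGap n A r := by
  unfold doublingGap
  have hK : 0 < (2 * (n : ℝ) + 1) / r ^ 2 := by positivity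
  have h1 := doublingRadius_le A
  have h2 := mul_doublingRadius_le A
  have h3 := doublingRadius_pos A
  rw [sub_pos, Real.exp_lt_exp, neg_mul, neg_mul, neg_lt_neg_iff]
  refine mul_lt_mul_of_pos_left ?_ hK
  -- Both the radius `R` and `A R` are at most `1/32`, so `R²/2 + 2AR ≤ 1/2048 + 1/16 < 1/8`.
  nlinarith

/-- The doubling inequality for `a = V^{1/n}`. -/
theorem jacobiFun_doubling (hn : 1 ≤ n) {A : ℝ≥0} (hsol : IsSmoothConvexSolution Θ u)
    (hA : c01Norm (Metric.ball 0 1) u ≤ (A : ℝ≥0∞)) {y : EuclideanSpace ℝ (Fin n)}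
    (hy : y ∈ Metric.ball (0 : EuclideanSpace ℝ (Fin n)) (1 / 2)) {r S : ℝ} (hr : 0 < r)
    -- No upper bound on `r` is assumed here, so `B_r(y)` may leave the domain of the equation.
    (hS : ∀ z ∈ Metric.ball y r, z ∈ Metric.ball (0 : EuclideanSpace ℝ (Fin n)) 2 →
      jacobiFun (hessian u z) ≤ S)
    {x : EuclideanSpace ℝ (Fin n)} (hx : x ∈ Metric.ball y (doublingRadius A)) :
    jacobiFun (hessian u x) ≤ (doublingGap n A r)⁻¹ * S := by
  set U := Metric.ball (0 : EuclideanSpace ℝ (Fin n)) 2 with hUdef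
  have hU : IsOpen U := Metric.isOpen_ball
  have hsub1 : Metric.closedBall y (1 / 2) ⊆ Metric.ball (0 : EuclideanSpace ℝ (Fin n)) 1 :=
    Metric.closedBall_subset_ball' (by rw [Metric.mem_ball] at hy; linarith)
  have hsub : Metric.closedBall y (1 / 2) ⊆ U :=
    hsub1.trans (Metric.ball_subset_ball (by norm_num))
  have hy' : y ∈ Metric.closedBall y (1 / 2) := Metric.mem_closedBall_self (by norm_num)
  have hSpos : 0 < S := by
    refine lt_of_lt_of_le ?_ (hS y (Metric.mem_ball_self hr) (hsub hy'))
    rw [jacobiFun_eq_exp hsol.solves (hsub hy')]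
    exact Real.exp_pos _
  set K : ℝ := (2 * n + 1) / r ^ 2 with hKdef
  have hK : 0 < K := by positivity
  let f : EuclideanSpace ℝ (Fin n) → ℝ := fun z => Real.exp (-(1 / n) * logVol u z) -
    S⁻¹ * (Real.exp (-K * barrier u y z) - Real.exp (-K * (1 / 8)))
  have hcont : ContinuousOn f (Metric.closedBall y (1 / 2)) := by
    have h1 := (contDiffOn_logVol hU hsol.smooth fun z hz => (hsol.solves z hz).1).continuousOn
    have h2 := continuousOn_barrier hU hsol.smooth y
    have h3 : ContinuousOn f U := by
      change ContinuousOn (fun z => Real.exp (-(1 / n) * logVol u z) -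
        S⁻¹ * (Real.exp (-K * barrier u y z) - Real.exp (-K * (1 / 8)))) U
      fun_prop
    exact h3.mono hsub
  obtain ⟨x₀, hx₀, hmin⟩ := (isCompact_closedBall y (1 / 2)).exists_isMinOn ⟨y, hy'⟩ hcont
  have hbar : ∀ z ∈ Metric.closedBall y (1 / 2), ‖z - y‖ ^ 2 / 2 ≤ barrier u y z := fun z hz =>
    half_sq_le_barrier hU hsol.smooth hsol.convex (hsub hz) (hsub hy')
  -- A negative minimum is impossible in three regions: in `B_r(y)` since `1/a ≥ S⁻¹`, on the sphere
  -- of radius `1/2` since the comparison function is nonpositive, and in between by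
  -- `not_isLocalMin_comparison`, as `K r² = 2n + 1 > 2n`.
  have hnonneg : 0 ≤ f x₀ := by
    by_contra! hneg
    rcases lt_or_ge (dist x₀ y) r with hnear | hfar
    · have h1 : S⁻¹ ≤ Real.exp (-(1 / n) * logVol u x₀) := by
        have := hS x₀ hnear (hsub hx₀)
        rw [jacobiFun_eq_exp hsol.solves (hsub hx₀)] at this
        rw [neg_mul, Real.exp_neg]
        exact inv_anti₀ (Real.exp_pos _) this
      have h2 : Real.exp (-K * barrier u y x₀) - Real.exp (-K * (1 / 8)) ≤ 1 := by
        have h3 : Real.exp (-K * barrier u y x₀) ≤ 1 := by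
          rw [Real.exp_le_one_iff, neg_mul, neg_nonpos]
          exact mul_nonneg hK.le (le_trans (by positivity) (hbar x₀ hx₀))
        linarith [Real.exp_pos (-K * (1 / 8))]
      have h3 := mul_le_mul_of_nonneg_left h2 (inv_pos.2 hSpos).le
      simp only [f] at hneg
      linarith
    rcases lt_or_eq_of_le (Metric.mem_closedBall.1 hx₀) with hin | hbd
    · refine not_isLocalMin_comparison hn hU hsol.smooth hsol.convex hsol.solves (hsub hx₀)
        (y := y) (c := Real.exp (-K * (1 / 8))) hK (inv_pos.2 hSpos) ?_
        (hmin.isLocalMin (Metric.closedBall_mem_nhds_of_mem hin))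
      rw [dist_eq_norm] at hfar
      calc 2 * (n : ℝ) < 2 * n + 1 := by linarith
        _ = K * r ^ 2 := by rw [hKdef]; field_simp
        _ ≤ K * ‖x₀ - y‖ ^ 2 := by gcongr
    · have h1 := hbar x₀ hx₀
      rw [← dist_eq_norm, hbd] at h1
      have h2 : Real.exp (-K * barrier u y x₀) ≤ Real.exp (-K * (1 / 8)) := by
        rw [Real.exp_le_exp]
        nlinarith
      have h3 : S⁻¹ * (Real.exp (-K * barrier u y x₀) - Real.exp (-K * (1 / 8))) ≤ 0 :=
        mul_nonpos_of_nonneg_of_nonpos (inv_pos.2 hSpos).le (by linarith)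
      have h4 := Real.exp_pos (-(1 / n) * logVol u x₀)
      simp only [f] at hneg
      linarith
  have hR := doublingRadius_le A
  have hxc : x ∈ Metric.closedBall y (1 / 2) := by
    rw [Metric.mem_ball] at hx
    rw [Metric.mem_closedBall]
    linarith
  have hfx : 0 ≤ f x := hnonneg.trans (hmin hxc)
  have hgap : doublingGap n A r ≤ Real.exp (-K * barrier u y x) - Real.exp (-K * (1 / 8)) := by
    unfold doublingGap
    refine sub_le_sub_right (Real.exp_le_exp.2 ?_) _
    rw [neg_mul, neg_mul, neg_le_neg_iff]
    refine mul_le_mul_of_nonneg_left ?_ hK.le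
    refine (barrier_le Metric.isOpen_ball (lipschitzOnWith_of_c01Norm_le hA) (hsub1 hxc)
      (hsub1 hy')).trans ?_
    have : ‖x - y‖ ≤ doublingRadius A := by
      rw [← dist_eq_norm]; exact (Metric.mem_ball.1 hx).le
    gcongr
  have hδ := doublingGap_pos n A hr
  have h1 : S⁻¹ * doublingGap n A r ≤ (jacobiFun (hessian u x))⁻¹ := by
    rw [jacobiFun_eq_exp hsol.solves (hsub hxc), ← Real.exp_neg, ← neg_mul]
    have := mul_le_mul_of_nonneg_left hgap (inv_pos.2 hSpos).le
    simp only [f] at hfx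
    linarith
  have hjpos : 0 < jacobiFun (hessian u x) := by
    rw [jacobiFun_eq_exp hsol.solves (hsub hxc)]
    exact Real.exp_pos _
  have h2 := inv_anti₀ (mul_pos (inv_pos.2 hSpos) hδ) h1
  rw [inv_inv, mul_inv, inv_inv, mul_comm] at h2
  exact h2

theorem bddAbove_image_ball {f : EuclideanSpace ℝ (Fin n) → ℝ}
    (hf : ContinuousOn f (Metric.ball 0 2)) {y : EuclideanSpace ℝ (Fin n)}
    (hy : y ∈ Metric.ball (0 : EuclideanSpace ℝ (Fin n)) (1 / 2)) {r : ℝ} (hr : r ≤ 1 / 2) :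
    BddAbove (f '' Metric.ball y r) := by
  have hsub : Metric.closedBall y (1 / 2) ⊆ Metric.ball (0 : EuclideanSpace ℝ (Fin n)) 2 :=
    Metric.closedBall_subset_ball' (by rw [Metric.mem_ball] at hy; linarith)
  exact ((isCompact_closedBall y (1 / 2)).bddAbove_image (hf.mono hsub)).mono
    (Set.image_mono (Metric.ball_subset_closedBall.trans (Metric.closedBall_subset_closedBall hr)))

theorem continuousOn_jacobiFun (hsol : IsSmoothConvexSolution Θ u) :
    ContinuousOn (fun x => jacobiFun (hessian u x)) (Metric.ball 0 2) :=
  ((contDiffOn_volDensity Metric.isOpen_ball hsol.smooth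
    fun z hz => (hsol.solves z hz).1).continuousOn).rpow_const fun x _ => Or.inr (by positivity)

theorem continuousOn_matrixNorm (hsol : IsSmoothConvexSolution Θ u) :
    ContinuousOn (fun x => matrixNorm (hessian u x)) (Metric.ball 0 2) := by
  unfold matrixNorm
  exact (continuousOn_finsetSum _ fun i _ => continuousOn_finsetSum _ fun j _ =>
    ((contDiffOn_hessian_apply Metric.isOpen_ball hsol.smooth i j).continuousOn).pow 2).sqrt

/-- A Hessian bound on `B_r(y)` propagates to the ball of radius `doublingRadius A`. -/
theorem matrixNorm_le_of_forall_ball (hn : 1 ≤ n) {A : ℝ≥0} (hsol : IsSmoothConvexSolution Θ u)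
    (hA : c01Norm (Metric.ball 0 1) u ≤ (A : ℝ≥0∞)) {y : EuclideanSpace ℝ (Fin n)}
    (hy : y ∈ Metric.ball (0 : EuclideanSpace ℝ (Fin n)) (1 / 2)) {r M : ℝ} (hr : 0 < r)
    (hM : ∀ z ∈ Metric.ball y r, matrixNorm (hessian u z) ≤ M)
    {x : EuclideanSpace ℝ (Fin n)} (hx : x ∈ Metric.ball y (doublingRadius A)) :
    matrixNorm (hessian u x) ≤
      ((doublingGap n A r)⁻¹ * Real.sqrt ((1 + M ^ 2) ^ n) ^ (1 / (n : ℝ))) ^ n := by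
  have hR := doublingRadius_le A
  have hsmall : ∀ z ∈ Metric.ball y r, z ∈ Metric.ball (0 : EuclideanSpace ℝ (Fin n)) 2 →
      jacobiFun (hessian u z) ≤ Real.sqrt ((1 + M ^ 2) ^ n) ^ (1 / (n : ℝ)) := by
    intro z hz hz2
    have hH := (hsol.solves z hz2).1
    exact Real.rpow_le_rpow (zero_le_one.trans (one_le_volDensity hH))
      (volDensity_le hH (hM z hz)) (by positivity)
  have hj := jacobiFun_doubling hn hsol hA hy hr hsmall hx
  have hx2 : x ∈ Metric.ball (0 : EuclideanSpace ℝ (Fin n)) 2 := by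
    rw [Metric.mem_ball] at hx hy ⊢
    linarith [dist_triangle x y 0]
  have hH := (hsol.solves x hx2).1
  have hV := one_le_volDensity hH
  -- The bound for `a` returns to `V = a^n`, which dominates `|H|`.
  have hpow : jacobiFun (hessian u x) ^ n = volDensity (hessian u x) := by
    rw [jacobiFun, one_div, Real.rpow_inv_natCast_pow (by linarith) (by omega)]
  calc matrixNorm (hessian u x) ≤ volDensity (hessian u x) := matrixNorm_le_volDensity hH
    _ = jacobiFun (hessian u x) ^ n := hpow.symm
    _ ≤ _ := pow_le_pow_left₀ (Real.rpow_nonneg (by linarith) _) hj n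

end Doubling
end SpecialLagrangian

/-! ### The main theorem. -/

theorem mainTheorem5 (n : ℕ) (hn : 1 ≤ n) (A : ℝ≥0) :
    ∃ R : ℝ, 0 < R ∧ R ≤ 1 / 2 ∧ ∀ r : ℝ, 0 < r → r ≤ R →
      (∃ C : ℝ, ∀ (Θ : ℝ) (u : EuclideanSpace ℝ (Fin n) → ℝ),
        SpecialLagrangian.IsSmoothConvexSolution Θ u →
        SpecialLagrangian.c01Norm (Metric.ball 0 1) u ≤ (A : ℝ≥0∞) →
        ∀ y ∈ Metric.ball (0 : EuclideanSpace ℝ (Fin n)) (1 / 2),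
          BddAbove ((fun x => SpecialLagrangian.jacobiFun (SpecialLagrangian.hessian u x)) ''
            Metric.ball y R) ∧
          sSup ((fun x => SpecialLagrangian.jacobiFun (SpecialLagrangian.hessian u x)) ''
              Metric.ball y R) ≤
            C * sSup ((fun x => SpecialLagrangian.jacobiFun (SpecialLagrangian.hessian u x)) ''
              Metric.ball y r)) ∧
      (∀ M : ℝ, ∃ C' : ℝ, ∀ (Θ : ℝ) (u : EuclideanSpace ℝ (Fin n) → ℝ),
        SpecialLagrangian.IsSmoothConvexSolution Θ u →
        SpecialLagrangian.c01Norm (Metric.ball 0 1) u ≤ (A : ℝ≥0∞) →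
        ∀ y ∈ Metric.ball (0 : EuclideanSpace ℝ (Fin n)) (1 / 2),
          sSup ((fun x => SpecialLagrangian.matrixNorm (SpecialLagrangian.hessian u x)) ''
            Metric.ball y r) ≤ M →
          BddAbove ((fun x => SpecialLagrangian.matrixNorm (SpecialLagrangian.hessian u x)) ''
            Metric.ball y R) ∧
          sSup ((fun x => SpecialLagrangian.matrixNorm (SpecialLagrangian.hessian u x)) ''
            Metric.ball y R) ≤ C') := by
  have hR := SpecialLagrangian.doublingRadius_le A
  have hR0 := SpecialLagrangian.doublingRadius_pos A
  refine ⟨SpecialLagrangian.doublingRadius A, hR0, by linarith, fun r hr hrR =>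
    ⟨⟨(SpecialLagrangian.doublingGap n A r)⁻¹, ?_⟩, fun M => ⟨((SpecialLagrangian.doublingGap n A r)⁻¹ *
      Real.sqrt ((1 + M ^ 2) ^ n) ^ (1 / (n : ℝ))) ^ n, ?_⟩⟩⟩
  · intro Θ u hsol hA y hy
    have hbdd := fun ρ => SpecialLagrangian.bddAbove_image_ball
      (SpecialLagrangian.continuousOn_jacobiFun hsol) hy (r := ρ)
    refine ⟨hbdd _ (by linarith), csSup_le ((Metric.nonempty_ball.2 hR0).image _) ?_⟩
    rintro _ ⟨x, hx, rfl⟩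
    exact SpecialLagrangian.jacobiFun_doubling hn hsol hA hy hr (fun z hz _ =>
      le_csSup (hbdd r (by linarith)) ⟨z, hz, rfl⟩) hx
  · intro Θ u hsol hA y hy hM
    have hbdd := fun ρ => SpecialLagrangian.bddAbove_image_ball
      (SpecialLagrangian.continuousOn_matrixNorm hsol) hy (r := ρ)
    refine ⟨hbdd _ (by linarith), csSup_le ((Metric.nonempty_ball.2 hR0).image _) ?_⟩
    rintro _ ⟨x, hx, rfl⟩
    -- Since `r ≤ 1/2`, the image of `B_r(y)` is bounded, so the hypothesis on `sSup` is a genuine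
    -- pointwise bound and not the default value of an unbounded set.
    exact SpecialLagrangian.matrixNorm_le_of_forall_ball hn hsol hA hy hr (fun z hz =>
      (le_csSup (hbdd r (by linarith)) ⟨z, hz, rfl⟩).trans hM) hx
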